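/- Let $V$ be a two-dimensional vector space over $\mathbb{Q}$ with a positive definite quadratic form $Q$ and the symmetric bilinear form $B(x,y)=\tfrac12\big(Q(x+y)-Q(x)-Q(y)\big)$. A binary $\mathbb{Z}$-lattice $L$ on $V$ is a finitely generated $\mathbb{Z}$-submodule $L\subset V$ that spans $V$ over $\mathbb{Q}$ and satisfies $Q(L)\subseteq\mathbb{Z}$. Its discriminant is $d_L=\det\big(B(e_i,e_j)\big)_{1\le i,j\le 2}$ for any $\mathbb{Z}$-basis $e_1,e_2$ of $L$. Let $O^+(V)$ be the group of $\mathbb{Q}$-linear automorphisms of $V$ that preserve $B$ and have determinant $1$. For $m\ge 1$ let $a_m^+(L)$ be the number of classes of sublattices $K\subseteq L$ of index $m$, where $K$ and $K'$ are in the same class if $\sigma(K)=K'$ for some $\sigma\in O^+(V)$. Put $$\zeta_L^{+}(s)=\sum_{m=1}^{\infty}a_m^+(L)\,m^{-s}.$$ Let $F$ be an imaginary quadratic field, and let $L_1$ and $L_2$ be binary $\mathbb{Z}$-lattices (possibly on different quadratic spaces) such that $-4d_{L_1}=-4d_{L_2}$ is the discriminant of $F$. Then both Dirichlet series $\zeta^{+}_{L_1}(s)$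 and $\zeta^{+}_{L_2}(s)$ converge absolutely for $\operatorname{Re}(s)>2$, and $\zeta^{+}_{L_1}(s)=\zeta^{+}_{L_2}(s)$, that is, $a_m^+(L_1)=a_m^+(L_2)$ for all $m\ge 1$, and the two series define the same function of $s$. Thus $\zeta^+_L$ depends only on the field $F$. -/

import Mathlib

namespace SublatticeZeta

open Module

section

variable {V : Type*} [AddCommGroup V] [Module ℚ V]

/-- The Gram matrix `(B(eᵢ, eⱼ))` of a lattice `L` on the quadratic space `(V, Q)` with respect to
a `ℤ`-basis `e` of `L`, where `2 B(x, y) = Q(x + y) - Q(x) - Q(y)`. -/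
noncomputable def gramMatrix (Q : QuadraticForm ℚ V) {L : Submodule ℤ V} {ι : Type*}
    (e : Basis ι ℤ L) : Matrix ι ι ℚ :=
  Matrix.of fun i j => QuadraticMap.associated Q (e i : V) (e j : V)

/-- The discriminant `d_L` of a lattice `L` on `(V, Q)`: the determinant of a Gram matrix of `L`.
It does not depend on the basis, see `discriminant_eq`. -/
noncomputable def discriminant (Q : QuadraticForm ℚ V) (L : Submodule ℤ V)
    [Submodule.IsLattice ℚ L] : ℚ :=
  haveI : Module.Free ℤ L := Submodule.IsLattice.free ℚ L
  (gramMatrix Q (Module.finBasis ℤ L)).det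

theorem det_gramMatrix_eq (Q : QuadraticForm ℚ V) {L : Submodule ℤ V} {ι : Type*}
    [Fintype ι] [DecidableEq ι] (e f : Basis ι ℤ L) :
    (gramMatrix Q e).det = (gramMatrix Q f).det := by
  have key : gramMatrix Q f = ((e.toMatrix f).map (Int.castRingHom ℚ)).transpose *
      gramMatrix Q e * (e.toMatrix f).map (Int.castRingHom ℚ) := by
    ext i j
    have hf : ∀ k, ((f k : L) : V) = ∑ a, ((e.toMatrix f a k : ℤ) : ℚ) • ((e a : L) : V) := by
      intro k
      have h := congrArg (Subtype.val : L → V) (e.sum_toMatrix_smul_self f k)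
      rw [← h]
      simp only [AddSubmonoidClass.coe_finsetSum, Submodule.coe_smul, Int.cast_smul_eq_zsmul]
    simp only [gramMatrix, Matrix.of_apply, Matrix.mul_apply, Matrix.transpose_apply,
      Matrix.map_apply, Finset.sum_mul]
    rw [hf i, hf j]
    simp only [map_sum, LinearMap.sum_apply, map_smul, LinearMap.smul_apply, smul_eq_mul]
    refine Finset.sum_congr rfl fun b _ => ?_
    rw [Finset.mul_sum]
    refine Finset.sum_congr rfl fun a _ => ?_
    simp
    ring
  have hu : IsUnit (e.toMatrix f).det := by
    have h := congrArg Matrix.det (e.toMatrix_mul_toMatrix_flip f)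
    rw [Matrix.det_mul, Matrix.det_one] at h
    exact IsUnit.of_mul_eq_one _ h
  have hd : ((e.toMatrix f).map (Int.castRingHom ℚ)).det = ((e.toMatrix f).det : ℚ) := by
    rw [← RingHom.mapMatrix_apply, ← RingHom.map_det]; simp
  rw [key, Matrix.det_mul, Matrix.det_mul, Matrix.det_transpose, hd]
  rcases Int.isUnit_iff.mp hu with h | h <;> simp [h]

/-- The discriminant of a lattice may be computed from any of its `ℤ`-bases. -/
theorem discriminant_eq (Q : QuadraticForm ℚ V) (L : Submodule ℤ V) [Submodule.IsLattice ℚ L]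
    {n : ℕ} (e : Basis (Fin n) ℤ L) : discriminant Q L = (gramMatrix Q e).det := by
  have : Module.Free ℤ L := Submodule.IsLattice.free ℚ L
  have hn : finrank ℤ L = n := by simpa using Module.finrank_eq_card_basis e
  subst hn
  exact det_gramMatrix_eq Q _ _

/-- The special orthogonal group `O⁺(V)`: linear automorphisms of `V` that preserve the bilinear
form `B` and have determinant `1`. -/
def specialOrthogonalGroup (Q : QuadraticForm ℚ V) : Subgroup (V ≃ₗ[ℚ] V) where
  carrier := {σ | (∀ x y, QuadraticMap.associated Q (σ x) (σ y) = QuadraticMap.associated Q x y) ∧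
    LinearEquiv.det σ = 1}
  one_mem' := ⟨fun _ _ => rfl, map_one _⟩
  mul_mem' := by
    rintro σ τ ⟨h1, h2⟩ ⟨h3, h4⟩
    refine ⟨fun x y => ?_, by rw [map_mul, h2, h4, one_mul]⟩
    rw [LinearEquiv.mul_apply, LinearEquiv.mul_apply, h1, h3]
  inv_mem' := by
    rintro σ ⟨h1, h2⟩
    refine ⟨fun x y => ?_, by rw [map_inv, h2, inv_one]⟩
    rw [← h1 (σ⁻¹ x) (σ⁻¹ y)]
    simp

/-- Two `ℤ`-submodules `K`, `K'` of `V` are properly isometric if `σ(K) = K'` for some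
`σ ∈ O⁺(V)`. -/
def ProperlyIsometric (Q : QuadraticForm ℚ V) (K K' : Submodule ℤ V) : Prop :=
  ∃ σ ∈ specialOrthogonalGroup Q, (fun x => σ x) '' (K : Set V) = (K' : Set V)

theorem properlyIsometric_equivalence (Q : QuadraticForm ℚ V) :
    Equivalence (ProperlyIsometric Q) where
  refl K := ⟨1, one_mem _, by simp⟩
  symm := by
    rintro K K' ⟨σ, hσ, h⟩
    refine ⟨σ⁻¹, inv_mem hσ, ?_⟩
    rw [← h, Set.image_image]
    simp [← LinearEquiv.mul_apply]
  trans := by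
    rintro K K' K'' ⟨σ, hσ, h⟩ ⟨τ, hτ, h'⟩
    refine ⟨τ * σ, mul_mem hτ hσ, ?_⟩
    rw [← h', ← h, Set.image_image]
    rfl

/-- The set of sublattices of `L` of index `m` (for `m ≥ 1`). -/
def sublattices (L : Submodule ℤ V) (m : ℕ) : Set (Submodule ℤ V) :=
  {K | K ≤ L ∧ K.toAddSubgroup.relIndex L.toAddSubgroup = m}

/-- Proper isometry on the set of sublattices of `L` of index `m`. -/
def sublatticeSetoid (Q : QuadraticForm ℚ V) (L : Submodule ℤ V) (m : ℕ) :
    Setoid (sublattices L m) where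
  r K K' := ProperlyIsometric Q K K'
  iseqv := (properlyIsometric_equivalence Q).comap Subtype.val

/-- `a_m⁺(L)`: the number of proper isometry classes of sublattices of `L` of index `m`. -/
noncomputable def properClassCount (Q : QuadraticForm ℚ V) (L : Submodule ℤ V) (m : ℕ) : ℕ :=
  Nat.card (Quotient (sublatticeSetoid Q L m))

/-- `ζ⁺_L(s) = ∑_{m ≥ 1} a_m⁺(L) m^{-s}`, the zeta function of proper isometry classes of `L`
(the term at `m = 0` of an `LSeries` is zero). -/
noncomputable def properZeta (Q : QuadraticForm ℚ V) (L : Submodule ℤ V) (s : ℂ) : ℂ :=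
  LSeries (fun m => (properClassCount Q L m : ℂ)) s

end

end SublatticeZeta

namespace SublatticeZeta
open Module

/-! ### Fundamental discriminants of quadratic fields. -/

section DiscriminantOfQuadraticField

variable {F : Type*} [Field F]

/-! In coordinates, a lattice with `-4 d_L = D = disc F` is a binary form of discriminant `D`,
primitive because `D` is fundamental (`isPrimitive_of_discr_eq`). Such a form `(a, b, c)` is the
norm form, divided by `a`, of the ideal with basis `a`, `(b + √D)/2`. Proper isometries are
multiplications by norm-one elements `(t + u√D)/2` of `F`.

Fix `m`. A primitive form represents values prime to `m`, so both leading coefficients may be taken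
prime to `m`. Multiplication by `a₂` is then a similitude `Φ` embedding `L₁` in `L₂` with index `n =
a₁a₂` prime to `m` (`exists_isCoprimeComparison`). Since `m` and `n` are coprime, `K ↦ L₁ ∩ Φ⁻¹(K)`
preserves index `m`.

This map also preserves and reflects proper isometry. An isometry `σ` between sublattices of index
`m` satisfies `mσ(L) ⊆ L`, a condition that is the same for `L₁` and `L₂` because primitivity gives
both the same multiplier ring (`zsmul_mem_of_automorph`). So `σ` is controlled up to `m` or `m²` by
this and up to `n` by `Φ`, and Bézout concludes. Classes therefore inject, and exchanging the
lattices gives equality. Convergence follows from bounding the number of sublattices by `σ₁(m)`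
through Hermite normal forms. -/

theorem exists_basis_one_of_notMem_range [Algebra ℚ F]
    (hF : finrank ℚ F = 2) {s : F} (hs : s ∉ (algebraMap ℚ F).range) :
    ∃ b : Basis (Fin 2) ℚ F, b 0 = 1 ∧ b 1 = s := by
  have hli : LinearIndependent ℚ ![(1 : F), s] := by
    rw [LinearIndependent.pair_iff' one_ne_zero]
    intro a ha
    exact hs ⟨a, by rw [← ha, Algebra.smul_def, mul_one]⟩
  refine ⟨basisOfLinearIndependentOfCardEqFinrank hli (by simp [hF]), by simp, by simp⟩

theorem trace_eq_zero_of_sq_mem_range [Algebra ℚ F]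
    (hF : finrank ℚ F = 2) {s : F} (hs : s ∉ (algebraMap ℚ F).range) {δ : ℚ}
    (hδ : s ^ 2 = algebraMap ℚ F δ) : Algebra.trace ℚ F s = 0 := by
  obtain ⟨b, h0, h1⟩ := exists_basis_one_of_notMem_range hF hs
  have h2 : s * s = δ • b 0 := by rw [← pow_two, hδ, h0, Algebra.smul_def, mul_one]
  have h3 : s * 1 = b 1 := by rw [h1, mul_one]
  rw [Algebra.trace_eq_matrix_trace b, Matrix.trace_fin_two]
  simp only [Algebra.leftMulMatrix_eq_repr_mul]
  rw [h0, h1, h3, h2]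
  simp

theorem discr_one_pair [Algebra ℚ F] (hF : finrank ℚ F = 2) (x : F) :
    Algebra.discr ℚ ![1, x] =
      2 * Algebra.trace ℚ F (x ^ 2) - Algebra.trace ℚ F x ^ 2 := by
  have h1 : Algebra.trace ℚ F 1 = 2 := by
    have := Algebra.trace_algebraMap (R := ℚ) (S := F) 1
    simpa [hF] using this
  rw [Algebra.discr_def, Matrix.det_fin_two]
  simp [Algebra.traceMatrix_apply, Algebra.traceForm_apply, h1, pow_two]

/-- A quadratic number field contains a square root of its discriminant. -/
theorem exists_sq_eq_discr [NumberField F] (hF : finrank ℚ F = 2) :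
    ∃ s : F, s ∉ (algebraMap ℚ F).range ∧ s ^ 2 = algebraMap ℚ F (NumberField.discr F) := by
  obtain ⟨θ, hθ⟩ : ∃ θ : F, θ ∉ (algebraMap ℚ F).range := by
    by_contra! h
    have : (⊥ : Subalgebra ℚ F) = ⊤ := by
      rw [eq_top_iff]; intro x _; exact h x
    have := Subalgebra.bot_eq_top_iff_finrank_eq_one.mp this
    omega
  obtain ⟨b, h0, h1⟩ := exists_basis_one_of_notMem_range hF hθ
  have hsq : θ ^ 2 = algebraMap ℚ F (b.repr (θ ^ 2) 0) + algebraMap ℚ F (b.repr (θ ^ 2) 1) * θ := by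
    conv_lhs => rw [← b.sum_repr (θ ^ 2)]
    simp [Fin.sum_univ_two, h0, h1, Algebra.smul_def]
  set y := b.repr (θ ^ 2) 0
  set x := b.repr (θ ^ 2) 1
  have hs0 : 2 * θ - algebraMap ℚ F x ∉ (algebraMap ℚ F).range := by
    rintro ⟨q, hq⟩
    exact hθ ⟨(q + x) / 2, by rw [map_div₀, map_add, hq]; simp⟩
  -- Completing the square in `θ² = xθ + y` makes `s²` rational. Then `1, s` has discriminant `4s²`,
  -- which differs from `disc F` by the square of a change-of-basis determinant `r`, so `2rs` is the
  -- root sought.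
  set s := 2 * θ - algebraMap ℚ F x with hs
  have hδ : s ^ 2 = algebraMap ℚ F (x ^ 2 + 4 * y) := by
    simp only [map_add, map_mul, map_pow, map_ofNat]
    linear_combination 4 * hsq
  obtain ⟨c, hc0, hc1⟩ := exists_basis_one_of_notMem_range hF hs0
  have hdisc : Algebra.discr ℚ ![1, s] = 4 * (x ^ 2 + 4 * y) := by
    rw [discr_one_pair hF, trace_eq_zero_of_sq_mem_range hF hs0 hδ, hδ, Algebra.trace_algebraMap, hF]
    simp; ring
  have hcard : Fintype.card (Free.ChooseBasisIndex ℤ (NumberField.RingOfIntegers F)) = 2 := by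
    rw [← finrank_eq_card_chooseBasisIndex, NumberField.RingOfIntegers.rank, hF]
  let B := (NumberField.integralBasis F).reindex (Fintype.equivFinOfCardEq hcard)
  have hB : (NumberField.discr F : ℚ) = Algebra.discr ℚ B := by
    rw [NumberField.coe_discr, Basis.coe_reindex, Algebra.discr_reindex]
  have hcB : Algebra.discr ℚ B = (c.toMatrix B).det ^ 2 * Algebra.discr ℚ c := by
    rw [← Algebra.discr_of_matrix_vecMul, Basis.toMatrix_map_vecMul]
  have hc : (c : Fin 2 → F) = ![1, s] := by
    ext i; fin_cases i <;> simp [hc0, hc1]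
  rw [hc, hdisc] at hcB
  set r := (c.toMatrix B).det
  have hr : r ≠ 0 := by
    intro h
    rw [← hB, h] at hcB
    exact NumberField.discr_ne_zero F (by exact_mod_cast (by simpa using hcB))
  refine ⟨algebraMap ℚ F (2 * r) * s, ?_, ?_⟩
  · rintro ⟨q, hq⟩
    refine hs0 ⟨q / (2 * r), ?_⟩
    rw [map_div₀, hq, mul_div_cancel_left₀]
    simpa using hr
  · rw [hB, hcB, mul_pow, hδ, ← map_pow, ← map_mul]
    congr 1; ring

/-- The discriminant of a quadratic field is fundamental: every binary quadratic form with this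
discriminant is primitive. -/
theorem isPrimitive_of_discr_eq [NumberField F] (hF : finrank ℚ F = 2) {a b c : ℤ}
    (h : b ^ 2 - 4 * a * c = NumberField.discr F) {p : ℕ} (hp : p.Prime)
    (ha : (p : ℤ) ∣ a) (hb : (p : ℤ) ∣ b) (hc : (p : ℤ) ∣ c) : False := by
  obtain ⟨s, hs, hs2⟩ := exists_sq_eq_discr hF
  obtain ⟨a, rfl⟩ := ha
  obtain ⟨b, rfl⟩ := hb
  obtain ⟨c, rfl⟩ := hc
  have hp0 : (p : F) ≠ 0 := by exact_mod_cast hp.ne_zero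
  have hD : (NumberField.discr F) = p ^ 2 * (b ^ 2 - 4 * a * c) := by rw [← h]; ring
  -- With `D = p²D'`, this is `(b + √D')/2`, an algebraic integer since `D' = b² - 4ac`. The order
  -- `ℤ[θ]` would have discriminant `D'`, smaller than that of the maximal order.
  set θ : F := (b + s / p) / 2 with hθ
  have hsθ : s = p * (2 * θ - b) := by rw [hθ]; field_simp; ring
  have hθ2 : θ ^ 2 = b * θ - a * c := by
    have h1 : s ^ 2 = (p : F) ^ 2 * (b ^ 2 - 4 * a * c) := by
      rw [hs2, hD]; simp
    rw [hsθ, mul_pow] at h1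
    have h2 := mul_left_cancel₀ (pow_ne_zero 2 hp0) h1
    linear_combination h2 / 4
  have hint : IsIntegral ℤ θ := by
    refine ⟨Polynomial.X ^ 2 - (Polynomial.C b * Polynomial.X - Polynomial.C (a * c)), ?_, ?_⟩
    · monicity!
    · rw [← Polynomial.aeval_def]
      simp [hθ2]
  have htrs : Algebra.trace ℚ F s = 0 := trace_eq_zero_of_sq_mem_range hF hs hs2
  have htr : Algebra.trace ℚ F θ = b := by
    have : θ = algebraMap ℚ F (b / 2) + (1 / (2 * p) : ℚ) • s := by
      rw [hθ, Algebra.smul_def]; simp; field_simp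
    rw [this, map_add, map_smul, htrs, Algebra.trace_algebraMap, hF]; simp; ring
  have htr2 : Algebra.trace ℚ F (θ ^ 2) = b ^ 2 - 2 * (a * c) := by
    have : θ ^ 2 = (b : ℚ) • θ - algebraMap ℚ F (a * c) := by
      rw [hθ2, Algebra.smul_def]; simp
    rw [this, map_sub, map_smul, htr, Algebra.trace_algebraMap, hF]; simp; ring
  let T : NumberField.RingOfIntegers F := ⟨θ, hint⟩
  have hcard : Fintype.card (Free.ChooseBasisIndex ℤ (NumberField.RingOfIntegers F)) = 2 := by
    rw [← finrank_eq_card_chooseBasisIndex, NumberField.RingOfIntegers.rank, hF]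
  let B := (NumberField.RingOfIntegers.basis F).reindex (Fintype.equivFinOfCardEq hcard)
  have hB : Algebra.discr ℤ B = NumberField.discr F := NumberField.discr_eq_discr F B
  have hT : Algebra.discr ℤ ![1, T] = (B.toMatrix ![1, T]).det ^ 2 * NumberField.discr F := by
    rw [← hB, ← Algebra.discr_of_matrix_vecMul, Basis.toMatrix_map_vecMul]
  have hTQ : ((Algebra.discr ℤ ![1, T] : ℤ) : ℚ) = Algebra.discr ℚ ![1, θ] := by
    have key (x y : NumberField.RingOfIntegers F) :
        ((Algebra.traceForm ℤ (NumberField.RingOfIntegers F) x y : ℤ) : ℚ) =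
          Algebra.traceForm ℚ F x y := by
      rw [Algebra.traceForm_apply, Algebra.traceForm_apply, Algebra.coe_trace_int]
      rfl
    have hTθ : (T : F) = θ := rfl
    rw [Algebra.discr_def, Algebra.discr_def, Matrix.det_fin_two, Matrix.det_fin_two]
    simp only [Algebra.traceMatrix_apply, Int.cast_sub, Int.cast_mul, key]
    simp [hTθ]
  rw [discr_one_pair hF, htr, htr2] at hTQ
  have hTD : Algebra.discr ℤ ![1, T] = b ^ 2 - 4 * a * c := by
    have : ((Algebra.discr ℤ ![1, T] : ℤ) : ℚ) = ((b ^ 2 - 4 * a * c : ℤ) : ℚ) := by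
      rw [hTQ]; push_cast; ring
    exact_mod_cast this
  rw [hTD, hD] at hT
  set k := (B.toMatrix ![1, T]).det
  have hne : b ^ 2 - 4 * a * c ≠ 0 := by
    intro h0
    rw [h0, mul_zero] at hD
    exact NumberField.discr_ne_zero F hD
  have h1 : (k * p) ^ 2 = 1 := by
    have : (b ^ 2 - 4 * a * c) * ((k * p) ^ 2) = (b ^ 2 - 4 * a * c) * 1 := by
      linear_combination -hT
    exact mul_left_cancel₀ hne this
  have h2 : IsUnit (p : ℤ) := .of_mul_eq_one (k ^ 2 * p) (by linear_combination h1)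
  rw [Int.ofNat_isUnit, Nat.isUnit_iff] at h2
  exact hp.one_lt.ne' h2

end DiscriminantOfQuadraticField
-- Lattices as binary forms, their automorphs, and the values they represent.
section BinaryForms

variable {V : Type*} [AddCommGroup V] [Module ℚ V]

/-- Coordinates `e` on `V` in which `L` is `ℤ²` and `Q` is the binary form
`a x² + b x y + c y²`. -/
structure IsFormCoord (Q : QuadraticForm ℚ V) (L : Submodule ℤ V) (a b c : ℤ)
    (e : (ℚ × ℚ) ≃ₗ[ℚ] V) : Prop where
  mem_iff : ∀ x y : ℚ, e (x, y) ∈ L ↔ (∃ k : ℤ, x = k) ∧ ∃ l : ℤ, y = l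
  form_eq : ∀ x y : ℚ, Q (e (x, y)) = a * x ^ 2 + b * (x * y) + c * y ^ 2

theorem two_mul_associated (Q : QuadraticForm ℚ V) (x y : V) :
    2 * QuadraticMap.associated Q x y = Q (x + y) - Q x - Q y := by
  have h := congrArg (fun B => B x y) (QuadraticMap.two_nsmul_associated ℚ Q)
  simp only [LinearMap.smul_apply, QuadraticMap.polarBilin_apply_apply, QuadraticMap.polar,
    nsmul_eq_mul, Nat.cast_ofNat] at h
  exact h

theorem IsFormCoord.associated_eq {Q : QuadraticForm ℚ V} {L : Submodule ℤ V} {a b c : ℤ}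
    {e : (ℚ × ℚ) ≃ₗ[ℚ] V} (h : IsFormCoord Q L a b c e) (x y z w : ℚ) :
    QuadraticMap.associated Q (e (x, y)) (e (z, w)) =
      a * (x * z) + b / 2 * (x * w + y * z) + c * (y * w) := by
  have h1 : e (x, y) + e (z, w) = e (x + z, y + w) := by rw [← map_add]; rfl
  have h2 := two_mul_associated Q (e (x, y)) (e (z, w))
  rw [h1, h.form_eq, h.form_eq, h.form_eq] at h2
  linear_combination (1 / 2) * h2

theorem exists_isFormCoord (hV : finrank ℚ V = 2) (Q : QuadraticForm ℚ V) (L : Submodule ℤ V)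
    [Submodule.IsLattice ℚ L] (hL : ∀ x ∈ L, ∃ n : ℤ, Q x = n) :
    ∃ (a b c : ℤ) (e : (ℚ × ℚ) ≃ₗ[ℚ] V), IsFormCoord Q L a b c e ∧
      -4 * discriminant Q L = ((b ^ 2 - 4 * a * c : ℤ) : ℚ) := by
  have : Module.Free ℤ L := Submodule.IsLattice.free ℚ L
  have : Module.Finite ℤ L := Module.Finite.iff_fg.mpr (Submodule.IsLattice.fg (A := ℚ))
  have hr : finrank ℤ L = 2 := by
    rw [← hV, finrank, finrank, Submodule.IsLattice.rank' ℚ L]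
  let E : Basis (Fin 2) ℤ L := finBasisOfFinrankEq ℤ L hr
  let e : (ℚ × ℚ) ≃ₗ[ℚ] V := (Basis.finTwoProd ℚ).equiv (E.extendOfIsLattice ℚ) (Equiv.refl _)
  have he : ∀ x y : ℚ, e (x, y) = x • (E 0 : V) + y • (E 1 : V) := by
    intro x y
    have h1 : ((x, y) : ℚ × ℚ) = x • Basis.finTwoProd ℚ 0 + y • Basis.finTwoProd ℚ 1 := by simp
    rw [h1, map_add, map_smul, map_smul, Basis.equiv_apply, Basis.equiv_apply]
    simp
  obtain ⟨a, ha⟩ := hL _ (E 0).2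
  obtain ⟨c, hc⟩ := hL _ (E 1).2
  -- The middle coefficient `d - a - c` is `2B(E 0, E 1)`: it is integral by polarization, although
  -- `B` itself may be half-integral on `L`.
  obtain ⟨d, hd⟩ := hL _ (E 0 + E 1).2
  have hp := two_mul_associated Q
  have hform : ∀ x y : ℚ, Q (e (x, y)) = a * x ^ 2 + (d - a - c : ℤ) * (x * y) + c * y ^ 2 := by
    intro x y
    have h1 := hp (x • (E 0 : V)) (y • (E 1 : V))
    have h2 := hp (E 0 : V) (E 1 : V)
    simp only [map_smul, LinearMap.smul_apply, smul_eq_mul, QuadraticMap.map_smul, ha, hc] at h1 h2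
    rw [Submodule.coe_add] at hd
    rw [hd] at h2
    rw [he]
    push_cast
    linear_combination -h1 + x * y * h2
  refine ⟨a, d - a - c, c, e, ⟨fun x y => ⟨fun h => ?_, ?_⟩, hform⟩, ?_⟩
  · have hs := congrArg Subtype.val (E.sum_repr ⟨_, h⟩)
    simp only [Fin.sum_univ_two, Submodule.coe_add, Submodule.coe_smul] at hs
    rw [← Int.cast_smul_eq_zsmul ℚ, ← Int.cast_smul_eq_zsmul ℚ, ← he] at hs
    have := e.injective hs
    simp only [Prod.mk.injEq] at this
    exact ⟨⟨_, this.1.symm⟩, ⟨_, this.2.symm⟩⟩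
  · rintro ⟨⟨k, rfl⟩, l, rfl⟩
    rw [he, Int.cast_smul_eq_zsmul, Int.cast_smul_eq_zsmul]
    exact L.add_mem (L.smul_mem _ (E 0).2) (L.smul_mem _ (E 1).2)
  · rw [discriminant_eq Q L E, Matrix.det_fin_two]
    simp only [gramMatrix, Matrix.of_apply]
    have h2 := hp (E 0 : V) (E 1 : V)
    have h3 := hp (E 1 : V) (E 0 : V)
    rw [add_comm] at h3
    rw [Submodule.coe_add] at hd
    rw [hd, ha, hc] at h2
    rw [hd, ha, hc] at h3
    rw [QuadraticMap.associated_eq_self_apply, QuadraticMap.associated_eq_self_apply, ha, hc]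
    push_cast
    set B := QuadraticMap.associated Q (E 0 : V) (E 1 : V)
    set B' := QuadraticMap.associated Q (E 1 : V) (E 0 : V)
    linear_combination 2 * B' * h2 + (d - a - c : ℚ) * h3

theorem det_eq_of_coord {σ : V ≃ₗ[ℚ] V} (e : (ℚ × ℚ) ≃ₗ[ℚ] V) {p q r s : ℚ}
    (h : ∀ x y, σ (e (x, y)) = e (p * x + r * y, q * x + s * y)) :
    LinearMap.det (σ : V →ₗ[ℚ] V) = p * s - r * q := by
  rw [← LinearMap.det_conj _ e.symm, ← LinearMap.det_toMatrix (Basis.finTwoProd ℚ),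
    Matrix.det_fin_two]
  simp [LinearMap.toMatrix_apply, h]

/-- The matrix is that of multiplication by `(t + u√D)/2` on the basis `a`, `(b + √D)/2`.
Determinant one turns the quadratic conditions on the entries into linear ones. -/
theorem exists_of_mem_specialOrthogonalGroup {Q : QuadraticForm ℚ V} {L : Submodule ℤ V}
    {a b c : ℤ} {e : (ℚ × ℚ) ≃ₗ[ℚ] V} (h : IsFormCoord Q L a b c e) (ha : a ≠ 0)
    {σ : V ≃ₗ[ℚ] V} (hσ : σ ∈ specialOrthogonalGroup Q) :
    ∃ t u : ℚ, ∀ x y, σ (e (x, y)) =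
      e ((t - b * u) / 2 * x - c * u * y, a * u * x + (t + b * u) / 2 * y) := by
  obtain ⟨hB, hdet⟩ := hσ
  obtain ⟨⟨p, q⟩, hpq⟩ := e.surjective (σ (e (1, 0)))
  obtain ⟨⟨r, s⟩, hrs⟩ := e.surjective (σ (e (0, 1)))
  have hlin : ∀ x y, σ (e (x, y)) = e (p * x + r * y, q * x + s * y) := by
    intro x y
    have h1 : ((x, y) : ℚ × ℚ) = x • (1, 0) + y • (0, 1) := by simp
    rw [h1, map_add, map_add, map_smul, map_smul, map_smul, map_smul, ← hpq, ← hrs,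
      ← map_smul, ← map_smul, ← map_add]
    congr 1
    simp [mul_comm]
  have hd : p * s - r * q = 1 := by
    rw [← det_eq_of_coord e hlin, ← LinearEquiv.coe_det, hdet]; rfl
  have h11 := hB (e (1, 0)) (e (1, 0))
  have h12 := hB (e (1, 0)) (e (0, 1))
  have h22 := hB (e (0, 1)) (e (0, 1))
  rw [← hpq, h.associated_eq, h.associated_eq] at h11
  rw [← hpq, ← hrs, h.associated_eq, h.associated_eq] at h12
  rw [← hrs, h.associated_eq, h.associated_eq] at h22
  have ha' : (a : ℚ) ≠ 0 := by exact_mod_cast ha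
  -- `G σ = σ⁻ᵀ G` for the Gram matrix `G`
  have e1 : a * p + b * q = a * s := by
    linear_combination s * h11 - q * h12 + (- a * p - b / 2 * q) * hd
  have e2 : a * r = - c * q := by
    linear_combination s * h12 - q * h22 - (a * r + b / 2 * s) * hd
  refine ⟨p + s, q / a, fun x y => ?_⟩
  rw [hlin]
  have f1 : (p + s - b * (q / a)) / 2 = p := by field_simp; linear_combination -e1
  have f2 : (p + s + b * (q / a)) / 2 = s := by field_simp; linear_combination e1
  have f3 : c * (q / a) = -r := by field_simp; linear_combination e2
  have f4 : a * (q / a) = q := by field_simp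
  rw [f1, f2, f3, f4]
  congr 2; ring


/-- For a prime `p`, one of the values at `(1,0)`, `(0,1)`, `(1,1)` is prime to `p`, since otherwise
`p` divides all three coefficients. Coprime moduli are combined by the Chinese remainder theorem
applied to the argument vector. -/
theorem exists_isCoprime_form_value {a b c : ℤ}
    (hprim : ∀ p : ℕ, p.Prime → (p : ℤ) ∣ a → (p : ℤ) ∣ b → (p : ℤ) ∣ c → False)
    (m : ℕ) (hm : m ≠ 0) : ∃ x y : ℤ, IsCoprime (a * x ^ 2 + b * (x * y) + c * y ^ 2) (m : ℤ) := by
  induction m using Nat.recOnPosPrimePosCoprime with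
  | zero => exact absurd rfl hm
  | one => exact ⟨0, 0, by simp [isCoprime_one_right]⟩
  | prime_pow p k hp hk =>
    have hpp := Nat.prime_iff_prime_int.mp hp
    have key : ∃ x y : ℤ, ¬ (p : ℤ) ∣ (a * x ^ 2 + b * (x * y) + c * y ^ 2) := by
      by_contra! h
      have h1 : (p : ℤ) ∣ a := by simpa using h 1 0
      have h2 : (p : ℤ) ∣ c := by simpa using h 0 1
      have h3 : (p : ℤ) ∣ b := by
        have := h 1 1
        simp only [one_pow, mul_one] at this
        have h4 := (dvd_add_left h2).mp this
        exact (dvd_add_right h1).mp h4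
      exact hprim p hp h1 h3 h2
    obtain ⟨x, y, h⟩ := key
    refine ⟨x, y, ?_⟩
    push_cast
    exact (((Prime.coprime_iff_not_dvd hpp).mpr h).symm).pow_right
  | coprime m₁ m₂ h₁ h₂ hco ih₁ ih₂ =>
    obtain ⟨x₁, y₁, hx₁⟩ := ih₁ (by omega)
    obtain ⟨x₂, y₂, hx₂⟩ := ih₂ (by omega)
    obtain ⟨u, v, huv⟩ := Nat.isCoprime_iff_coprime.mpr hco
    refine ⟨u * m₁ * x₂ + v * m₂ * x₁, u * m₁ * y₂ + v * m₂ * y₁, ?_⟩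
    push_cast
    apply IsCoprime.mul_right
    · have hv : v * m₂ = 1 - u * m₁ := by linear_combination huv
      rw [hv]
      have key : a * (u * m₁ * x₂ + (1 - u * m₁) * x₁) ^ 2 +
          b * ((u * m₁ * x₂ + (1 - u * m₁) * x₁) * (u * m₁ * y₂ + (1 - u * m₁) * y₁)) +
          c * (u * m₁ * y₂ + (1 - u * m₁) * y₁) ^ 2 =
          a * x₁ ^ 2 + b * (x₁ * y₁) + c * y₁ ^ 2 +
            m₁ * (u * (a * (2 * x₁ * (x₂ - x₁) + u * m₁ * (x₂ - x₁) ^ 2)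
        + b * (x₁ * (y₂ - y₁) + y₁ * (x₂ - x₁) + u * m₁ * (x₂ - x₁) * (y₂ - y₁))
        + c * (2 * y₁ * (y₂ - y₁) + u * m₁ * (y₂ - y₁) ^ 2))) := by
        ring
      rw [key]
      exact hx₁.add_mul_left_left _
    · have hu : u * m₁ = 1 - v * m₂ := by linear_combination huv
      rw [hu]
      have key : a * ((1 - v * m₂) * x₂ + v * m₂ * x₁) ^ 2 +
          b * (((1 - v * m₂) * x₂ + v * m₂ * x₁) * ((1 - v * m₂) * y₂ + v * m₂ * y₁)) +
          c * ((1 - v * m₂) * y₂ + v * m₂ * y₁) ^ 2 =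
          a * x₂ ^ 2 + b * (x₂ * y₂) + c * y₂ ^ 2 +
            m₂ * (v * (a * (2 * x₂ * (x₁ - x₂) + v * m₂ * (x₁ - x₂) ^ 2)
        + b * (x₂ * (y₁ - y₂) + y₂ * (x₁ - x₂) + v * m₂ * (x₁ - x₂) * (y₁ - y₂))
        + c * (2 * y₂ * (y₁ - y₂) + v * m₂ * (y₁ - y₂) ^ 2))) := by
        ring
      rw [key]
      exact hx₂.add_mul_left_left _

theorem exists_isCoprime_isCoprime_form_value {a b c : ℤ}
    (hprim : ∀ p : ℕ, p.Prime → (p : ℤ) ∣ a → (p : ℤ) ∣ b → (p : ℤ) ∣ c → False)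
    (m : ℕ) (hm : m ≠ 0) : ∃ x y : ℤ, IsCoprime x y ∧
      IsCoprime (a * x ^ 2 + b * (x * y) + c * y ^ 2) (m : ℤ) := by
  -- The factor `2` rules out `x = y = 0` when `m = 1`, so that the gcd can be divided out.
  obtain ⟨x, y, h⟩ := exists_isCoprime_form_value hprim (2 * m) (by omega)
  have hxy : 0 < Int.gcd x y := by
    rw [Int.gcd_pos_iff]
    by_contra! h0
    rw [h0.1, h0.2] at h
    simp only [ne_eq, OfNat.ofNat_ne_zero, not_false_eq_true, zero_pow, mul_zero, add_zero,
      isCoprime_zero_left, Int.isUnit_iff] at h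
    omega
  obtain ⟨g, x', y', -, hg, hx, hy⟩ := Int.exists_gcd_one' hxy
  refine ⟨x', y', Int.isCoprime_iff_gcd_eq_one.mpr hg, ?_⟩
  push_cast at h
  refine IsCoprime.of_isCoprime_of_dvd_left h.of_mul_right_right ⟨g ^ 2, ?_⟩
  rw [hx, hy]; ring

theorem IsFormCoord.exists_isCoprime {Q : QuadraticForm ℚ V} {L : Submodule ℤ V} {a b c : ℤ}
    {e : (ℚ × ℚ) ≃ₗ[ℚ] V} (h : IsFormCoord Q L a b c e)
    (hprim : ∀ p : ℕ, p.Prime → (p : ℤ) ∣ a → (p : ℤ) ∣ b → (p : ℤ) ∣ c → False)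
    (m : ℕ) (hm : m ≠ 0) : ∃ (a' b' c' : ℤ) (e' : (ℚ × ℚ) ≃ₗ[ℚ] V), IsFormCoord Q L a' b' c' e' ∧
      b' ^ 2 - 4 * a' * c' = b ^ 2 - 4 * a * c ∧ IsCoprime a' (m : ℤ) := by
  obtain ⟨x, y, ⟨s, r, hxy⟩, hm⟩ := exists_isCoprime_isCoprime_form_value hprim m hm
  have hxy' : (s * x + r * y : ℚ) = 1 := by exact_mod_cast hxy
  -- The primitive vector `(x, y)` is completed to a basis of `ℤ²` with determinant `1`, which makes
  -- the represented value the new leading coefficient.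
  let M : (ℚ × ℚ) ≃ₗ[ℚ] (ℚ × ℚ) :=
    { toFun := fun v => (x * v.1 - r * v.2, y * v.1 + s * v.2)
      invFun := fun v => (s * v.1 + r * v.2, -y * v.1 + x * v.2)
      map_add' := fun v w => by ext <;> simp <;> ring
      map_smul' := fun v w => by ext <;> simp <;> ring
      left_inv := fun v => by
        ext
        · simp only; linear_combination v.1 * hxy'
        · simp only; linear_combination v.2 * hxy'
      right_inv := fun v => by
        ext
        · simp only; linear_combination v.1 * hxy'
        · simp only; linear_combination v.2 * hxy' }
  have hM (X Y : ℚ) : (M.trans e) (X, Y) = e (x * X - r * Y, y * X + s * Y) := rfl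
  refine ⟨a * x ^ 2 + b * (x * y) + c * y ^ 2,
    -2 * a * x * r + b * (x * s - y * r) + 2 * c * y * s, a * r ^ 2 - b * (r * s) + c * s ^ 2,
    M.trans e, ⟨fun X Y => ?_, fun X Y => ?_⟩, ?_, hm⟩
  · rw [hM, h.mem_iff]
    constructor
    · rintro ⟨⟨k, hk⟩, l, hl⟩
      refine ⟨⟨s * k + r * l, ?_⟩, ⟨-y * k + x * l, ?_⟩⟩
      · push_cast; rw [← hk, ← hl]; linear_combination -X * hxy'
      · push_cast; rw [← hk, ← hl]; linear_combination -Y * hxy'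
    · rintro ⟨⟨k, rfl⟩, l, rfl⟩
      exact ⟨⟨x * k - r * l, by push_cast; ring⟩, ⟨y * k + s * l, by push_cast; ring⟩⟩
  · rw [hM, h.form_eq]; push_cast; ring
  · linear_combination (b ^ 2 - 4 * a * c) * (s * x + r * y + 1) * hxy

theorem exists_bezout_of_isPrimitive {a b c : ℤ}
    (hprim : ∀ p : ℕ, p.Prime → (p : ℤ) ∣ a → (p : ℤ) ∣ b → (p : ℤ) ∣ c → False) :
    ∃ α β γ : ℤ, α * a + β * b + γ * c = 1 := by
  have h : Int.gcd (Int.gcd a b) c = 1 := by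
    by_contra hne
    obtain ⟨p, hp, hdvd⟩ := Nat.exists_prime_and_dvd hne
    have h1 : (p : ℤ) ∣ Int.gcd (Int.gcd a b) c := by exact_mod_cast hdvd
    have h2 := h1.trans (Int.gcd_dvd_left _ _)
    exact hprim p hp (h2.trans (Int.gcd_dvd_left _ _)) (h2.trans (Int.gcd_dvd_right _ _))
      (h1.trans (Int.gcd_dvd_right _ _))
  obtain ⟨u, v, huv⟩ := Int.isCoprime_iff_gcd_eq_one.mpr h
  refine ⟨u * Int.gcdA a b, u * Int.gcdB a b, v, ?_⟩
  rw [← huv, Int.gcd_eq_gcd_ab]; ring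

end BinaryForms
-- The similitude comparing two lattices of equal discriminant.
section Comparison

variable {V₁ : Type*} [AddCommGroup V₁] [Module ℚ V₁] {V₂ : Type*} [AddCommGroup V₂] [Module ℚ V₂]

/-- If two primitive forms have the same discriminant, the automorphs with the same parameters
`t`, `u` become integral after multiplication by the same integers. -/
theorem zsmul_mem_of_automorph {Q₁ : QuadraticForm ℚ V₁} {L₁ : Submodule ℤ V₁} {a₁ b₁ c₁ : ℤ}
    {e₁ : (ℚ × ℚ) ≃ₗ[ℚ] V₁} (h₁ : IsFormCoord Q₁ L₁ a₁ b₁ c₁ e₁)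
    (hprim : ∀ p : ℕ, p.Prime → (p : ℤ) ∣ a₁ → (p : ℤ) ∣ b₁ → (p : ℤ) ∣ c₁ → False)
    {Q₂ : QuadraticForm ℚ V₂} {L₂ : Submodule ℤ V₂} {a₂ b₂ c₂ : ℤ}
    {e₂ : (ℚ × ℚ) ≃ₗ[ℚ] V₂} (h₂ : IsFormCoord Q₂ L₂ a₂ b₂ c₂ e₂)
    {k : ℤ} (hk : b₁ = b₂ + 2 * k) {σ₁ : V₁ ≃ₗ[ℚ] V₁} {σ₂ : V₂ ≃ₗ[ℚ] V₂} {t u : ℚ}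
    (hσ₁ : ∀ x y, σ₁ (e₁ (x, y)) =
      e₁ ((t - b₁ * u) / 2 * x - c₁ * u * y, a₁ * u * x + (t + b₁ * u) / 2 * y))
    (hσ₂ : ∀ x y, σ₂ (e₂ (x, y)) =
      e₂ ((t - b₂ * u) / 2 * x - c₂ * u * y, a₂ * u * x + (t + b₂ * u) / 2 * y))
    {m : ℤ} (hm : ∀ x ∈ L₁, m • σ₁ x ∈ L₁) (x : V₂) (hx : x ∈ L₂) : m • σ₂ x ∈ L₂ := by
  obtain ⟨α, β, γ, hαβγ⟩ := exists_bezout_of_isPrimitive hprim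
  have h10 := hm (e₁ (1, 0)) ((h₁.mem_iff _ _).mpr ⟨⟨1, by simp⟩, 0, by simp⟩)
  have h01 := hm (e₁ (0, 1)) ((h₁.mem_iff _ _).mpr ⟨⟨0, by simp⟩, 1, by simp⟩)
  rw [← Int.cast_smul_eq_zsmul ℚ, hσ₁, ← map_smul, Prod.smul_mk, h₁.mem_iff] at h10 h01
  obtain ⟨⟨p, hp⟩, q, hq⟩ := h10
  obtain ⟨⟨r, hr⟩, s, hs⟩ := h01
  simp only [mul_one, mul_zero, sub_zero, add_zero, zero_sub, zero_add, smul_eq_mul] at hp hq hr hs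
  have hαβγ' : (α * a₁ + β * b₁ + γ * c₁ : ℚ) = 1 := by exact_mod_cast hαβγ
  have hk' : (b₁ : ℚ) = b₂ + 2 * k := by exact_mod_cast hk
  -- The integral matrix of `mσ₁` exhibits `m·a₁u`, `m·b₁u` (the difference of its diagonal entries)
  -- and `-m·c₁u`. Primitivity then forces `mu` itself to be an integer.
  obtain ⟨w, hw⟩ : ∃ w : ℤ, m * u = w :=
    ⟨α * q + β * (s - p) - γ * r, by
      push_cast; rw [← hp, ← hq, ← hr, ← hs]; linear_combination - m * u * hαβγ'⟩
  obtain ⟨⟨X, Y⟩, rfl⟩ := e₂.surjective x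
  obtain ⟨⟨X, rfl⟩, Y, rfl⟩ := (h₂.mem_iff _ _).mp hx
  rw [← Int.cast_smul_eq_zsmul ℚ, hσ₂, ← map_smul, Prod.smul_mk, h₂.mem_iff]
  constructor
  · refine ⟨(p + k * w) * X - c₂ * w * Y, ?_⟩
    push_cast; rw [smul_eq_mul, ← hp, ← hw, hk']; ring
  · refine ⟨a₂ * w * X + (p + k * w + b₂ * w) * Y, ?_⟩
    push_cast; rw [smul_eq_mul, ← hp, ← hw, hk']; ring

/-- A linear isomorphism `V₁ ≃ V₂` that intertwines the special orthogonal groups, embeds `L₁`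
into `L₂` with index prime to `m`, and respects the integrality of multiples by `m` of
isometries. -/
structure IsCoprimeComparison (Q₁ : QuadraticForm ℚ V₁) (L₁ : Submodule ℤ V₁)
    (Q₂ : QuadraticForm ℚ V₂) (L₂ : Submodule ℤ V₂) (m : ℕ) (n : ℤ) (Φ : V₁ ≃ₗ[ℚ] V₂) : Prop where
  isCoprime : IsCoprime n (m : ℤ)
  map_mem : ∀ x ∈ L₁, Φ x ∈ L₂
  symm_zsmul_mem : ∀ y ∈ L₂, Φ.symm (n • y) ∈ L₁
  conj_mem_iff : ∀ σ : V₁ ≃ₗ[ℚ] V₁, (Φ.symm.trans (σ.trans Φ)) ∈ specialOrthogonalGroup Q₂ ↔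
    σ ∈ specialOrthogonalGroup Q₁
  zsmul_mem_iff : ∀ σ ∈ specialOrthogonalGroup Q₁,
    ((∀ x ∈ L₁, (m : ℤ) • σ x ∈ L₁) ↔ ∀ y ∈ L₂, (m : ℤ) • Φ (σ (Φ.symm y)) ∈ L₂)

theorem conj_mem_specialOrthogonalGroup_iff {Q₁ : QuadraticForm ℚ V₁} {Q₂ : QuadraticForm ℚ V₂}
    (Φ : V₁ ≃ₗ[ℚ] V₂) {n : ℚ} (hn : n ≠ 0)
    (hΦ : ∀ x, Q₂ (Φ x) = n * Q₁ x) (σ : V₁ ≃ₗ[ℚ] V₁) :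
    (Φ.symm.trans (σ.trans Φ)) ∈ specialOrthogonalGroup Q₂ ↔ σ ∈ specialOrthogonalGroup Q₁ := by
  have hB (x y : V₁) : QuadraticMap.associated Q₂ (Φ x) (Φ y) =
      n * QuadraticMap.associated Q₁ x y := by
    have h1 := two_mul_associated Q₂ (Φ x) (Φ y)
    rw [← map_add, hΦ, hΦ, hΦ] at h1
    linear_combination (1 / 2) * h1 - (n / 2) * two_mul_associated Q₁ x y
  refine and_congr ⟨fun h x y => ?_, fun h x y => ?_⟩ ?_
  · have := h (Φ x) (Φ y)
    simp only [LinearEquiv.trans_apply, LinearEquiv.symm_apply_apply, hB] at this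
    exact mul_left_cancel₀ hn this
  · obtain ⟨x, rfl⟩ := Φ.surjective x
    obtain ⟨y, rfl⟩ := Φ.surjective y
    simp only [LinearEquiv.trans_apply, LinearEquiv.symm_apply_apply, hB, h]
  · rw [← LinearEquiv.trans_assoc, LinearEquiv.det_conj]

theorem exists_isCoprimeComparison {Q₁ : QuadraticForm ℚ V₁} {L₁ : Submodule ℤ V₁} {a₁ b₁ c₁ : ℤ}
    {e₁ : (ℚ × ℚ) ≃ₗ[ℚ] V₁} (h₁ : IsFormCoord Q₁ L₁ a₁ b₁ c₁ e₁)
    (hprim₁ : ∀ p : ℕ, p.Prime → (p : ℤ) ∣ a₁ → (p : ℤ) ∣ b₁ → (p : ℤ) ∣ c₁ → False)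
    {Q₂ : QuadraticForm ℚ V₂} {L₂ : Submodule ℤ V₂} {a₂ b₂ c₂ : ℤ}
    {e₂ : (ℚ × ℚ) ≃ₗ[ℚ] V₂} (h₂ : IsFormCoord Q₂ L₂ a₂ b₂ c₂ e₂)
    (hprim₂ : ∀ p : ℕ, p.Prime → (p : ℤ) ∣ a₂ → (p : ℤ) ∣ b₂ → (p : ℤ) ∣ c₂ → False)
    (hD : b₁ ^ 2 - 4 * a₁ * c₁ = b₂ ^ 2 - 4 * a₂ * c₂) (ha₁ : a₁ ≠ 0) (ha₂ : a₂ ≠ 0) {m : ℕ}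
    (hm₁ : IsCoprime a₁ (m : ℤ)) (hm₂ : IsCoprime a₂ (m : ℤ)) :
    ∃ (n : ℤ) (Φ : V₁ ≃ₗ[ℚ] V₂), IsCoprimeComparison Q₁ L₁ Q₂ L₂ m n Φ := by
  obtain ⟨k, hk⟩ : ∃ k, b₁ = b₂ + 2 * k := by
    have h1 : (2 : ℤ) ∣ (b₁ - b₂) ^ 2 :=
      ⟨2 * (a₁ * c₁ - a₂ * c₂) + b₂ * b₂ - b₁ * b₂, by linear_combination hD⟩
    obtain ⟨k, hk⟩ := Int.prime_two.dvd_of_dvd_pow h1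
    exact ⟨k, by linear_combination hk⟩
  have hk' : (b₁ : ℚ) = b₂ + 2 * k := by exact_mod_cast hk
  have hD' : (b₁ ^ 2 - 4 * a₁ * c₁ : ℚ) = b₂ ^ 2 - 4 * a₂ * c₂ := by exact_mod_cast hD
  have hA₁ : (a₁ : ℚ) ≠ 0 := by exact_mod_cast ha₁
  have hA₂ : (a₂ : ℚ) ≠ 0 := by exact_mod_cast ha₂
  -- Multiplication by `a₂`, from the basis `a₁`, `(b₁ + √D)/2` to the basis `a₂`, `(b₂ + √D)/2`;
  -- here `(b₁ + √D)/2 = k + (b₂ + √D)/2`. It scales the form by its determinant `a₁a₂`.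
  let M : (ℚ × ℚ) ≃ₗ[ℚ] (ℚ × ℚ) :=
    { toFun := fun v => (a₁ * v.1 + k * v.2, a₂ * v.2)
      invFun := fun v => ((v.1 - k * (v.2 / a₂)) / a₁, v.2 / a₂)
      map_add' := fun v w => by ext <;> simp <;> ring
      map_smul' := fun v w => by ext <;> simp <;> ring
      left_inv := fun v => by ext <;> simp [hA₁, hA₂]
      right_inv := fun v => by
        ext
        · simp; field_simp; ring
        · simp; field_simp }
  let Φ : V₁ ≃ₗ[ℚ] V₂ := e₁.symm.trans (M.trans e₂)
  have hΦ (x y : ℚ) : Φ (e₁ (x, y)) = e₂ (a₁ * x + k * y, a₂ * y) := by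
    simp only [Φ, LinearEquiv.trans_apply, LinearEquiv.symm_apply_apply]; rfl
  have hQ : ∀ v, Q₂ (Φ v) = (a₁ * a₂ : ℚ) * Q₁ v := by
    intro v
    obtain ⟨⟨x, y⟩, rfl⟩ := e₁.surjective v
    rw [hΦ, h₂.form_eq, h₁.form_eq]
    rw [hk'] at hD' ⊢
    linear_combination (a₂ * y ^ 2 / 4) * hD'
  refine ⟨a₁ * a₂, Φ, ⟨hm₁.mul_left hm₂, ?_, ?_,
    conj_mem_specialOrthogonalGroup_iff Φ (mul_ne_zero hA₁ hA₂) hQ, ?_⟩⟩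
  · intro v hv
    obtain ⟨⟨x, y⟩, rfl⟩ := e₁.surjective v
    obtain ⟨⟨x, rfl⟩, y, rfl⟩ := (h₁.mem_iff _ _).mp hv
    rw [hΦ, h₂.mem_iff]
    exact ⟨⟨a₁ * x + k * y, by push_cast; ring⟩, a₂ * y, by push_cast; ring⟩
  · intro v hv
    obtain ⟨⟨x, y⟩, rfl⟩ := e₂.surjective v
    obtain ⟨⟨x, rfl⟩, y, rfl⟩ := (h₂.mem_iff _ _).mp hv
    have : Φ (e₁ ((a₂ * x - k * y : ℤ), (a₁ * y : ℤ))) = (a₁ * a₂) • e₂ ((x : ℚ), (y : ℚ)) := by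
      rw [hΦ, ← Int.cast_smul_eq_zsmul ℚ, ← map_smul]
      congr 1
      simp only [Prod.smul_mk, smul_eq_mul, Prod.mk.injEq]
      push_cast
      exact ⟨by ring, by ring⟩
    rw [← this, LinearEquiv.symm_apply_apply, h₁.mem_iff]
    exact ⟨⟨_, rfl⟩, _, rfl⟩
  · intro σ hσ
    obtain ⟨t, u, htu⟩ := exists_of_mem_specialOrthogonalGroup h₁ ha₁ hσ
    have htu₂ : ∀ x y, (Φ.symm.trans (σ.trans Φ)) (e₂ (x, y)) =
        e₂ ((t - b₂ * u) / 2 * x - c₂ * u * y, a₂ * u * x + (t + b₂ * u) / 2 * y) := by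
      intro x y
      have hinv : e₂ (x, y) = Φ (e₁ ((x - k * (y / a₂)) / a₁, y / a₂)) := by
        rw [hΦ]; congr 2 <;> field_simp; ring
      rw [hinv]
      simp only [LinearEquiv.trans_apply, LinearEquiv.symm_apply_apply]
      rw [htu, hΦ, hk']
      rw [hk'] at hD'
      congr 2
      · field_simp
        linear_combination (u * y / 2) * hD'
      · field_simp
        ring
    exact ⟨fun h => zsmul_mem_of_automorph h₁ hprim₁ h₂ hk htu htu₂ h,
      fun h => zsmul_mem_of_automorph h₂ hprim₂ h₁ (k := -k) (by linear_combination -hk) htu₂ htu h⟩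

end Comparison
-- Transport of sublattices and their proper isometry classes.
theorem zsmul_mem_of_mem_sublattices {V : Type*} [AddCommGroup V]
    {L K : Submodule ℤ V} {m : ℕ}
    (hK : K ∈ sublattices L m) {x : V} (hx : x ∈ L) : (m : ℤ) • x ∈ K := by
  have h := (K.toAddSubgroup.addSubgroupOf L.toAddSubgroup).nsmul_index_mem ⟨x, hx⟩
  rw [show (K.toAddSubgroup.addSubgroupOf L.toAddSubgroup).index = m from hK.2] at h
  rw [natCast_zsmul]
  exact h

section Comparison

variable {V₁ : Type*} [AddCommGroup V₁] [Module ℚ V₁] {V₂ : Type*} [AddCommGroup V₂] [Module ℚ V₂]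

theorem properlyIsometric_iff {Q : QuadraticForm ℚ V₁} {K K' : Submodule ℤ V₁} :
    ProperlyIsometric Q K K' ↔ ∃ σ ∈ specialOrthogonalGroup Q, ∀ x, σ x ∈ K' ↔ x ∈ K := by
  refine exists_congr fun σ => and_congr_right fun _ => ⟨fun h x => ?_, fun h => ?_⟩
  · rw [← SetLike.mem_coe, ← h]
    exact σ.injective.mem_set_image
  · ext y
    obtain ⟨x, rfl⟩ := σ.surjective y
    rw [σ.injective.mem_set_image]
    exact (h x).symm

/-- The part of `L₁` that a linear isomorphism `Φ` carries into `K`. -/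
def pullback (L₁ : Submodule ℤ V₁) (Φ : V₁ ≃ₗ[ℚ] V₂) (K : Submodule ℤ V₂) : Submodule ℤ V₁ :=
  L₁ ⊓ K.comap (Φ : V₁ →ₗ[ℚ] V₂).toAddMonoidHom.toIntLinearMap

theorem mem_pullback {L₁ : Submodule ℤ V₁} {Φ : V₁ ≃ₗ[ℚ] V₂} {K : Submodule ℤ V₂} {x : V₁} :
    x ∈ pullback L₁ Φ K ↔ x ∈ L₁ ∧ Φ x ∈ K := Iff.rfl

namespace IsCoprimeComparison

variable {Q₁ : QuadraticForm ℚ V₁} {L₁ : Submodule ℤ V₁} {Q₂ : QuadraticForm ℚ V₂}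
  {L₂ : Submodule ℤ V₂} {m : ℕ} {n : ℤ} {Φ : V₁ ≃ₗ[ℚ] V₂}

/-- As `mL₂ ⊆ K` and `nL₂ ⊆ Φ(L₁)` with `m`, `n` coprime, `K + Φ(L₁) = L₂`. The second isomorphism
theorem then gives the index. -/
theorem pullback_mem_sublattices (h : IsCoprimeComparison Q₁ L₁ Q₂ L₂ m n Φ)
    {K : Submodule ℤ V₂} (hK : K ∈ sublattices L₂ m) :
    pullback L₁ Φ K ∈ sublattices L₁ m := by
  refine ⟨inf_le_left, ?_⟩
  let φ : V₁ →+ V₂ := (Φ : V₁ →ₗ[ℚ] V₂).toAddMonoidHom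
  have h1 : (pullback L₁ Φ K).toAddSubgroup = L₁.toAddSubgroup ⊓ K.toAddSubgroup.comap φ := rfl
  have h2 : K.toAddSubgroup ⊔ L₁.toAddSubgroup.map φ = L₂.toAddSubgroup := by
    apply le_antisymm
    · refine sup_le hK.1 ?_
      rintro _ ⟨x, hx, rfl⟩
      exact h.map_mem x hx
    · intro y hy
      obtain ⟨u, v, huv⟩ := h.isCoprime
      have h3 : y = v • ((m : ℤ) • y) + Φ (u • Φ.symm (n • y)) := by
        rw [map_zsmul, LinearEquiv.apply_symm_apply, smul_smul, smul_smul, ← add_smul, add_comm,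
          huv, one_smul]
      rw [h3]
      exact AddSubgroup.add_mem_sup (K.smul_mem v (zsmul_mem_of_mem_sublattices hK hy))
        ⟨_, L₁.smul_mem u (h.symm_zsmul_mem y hy), rfl⟩
  rw [h1, AddSubgroup.inf_relIndex_left, AddSubgroup.relIndex_comap,
    ← AddSubgroup.relIndex_sup_left, h2, hK.2]

/-- Write `z` for the image of `y`. Then `nz ∈ K'` because `ny` comes from the pullback of `K`, and
`m²z ∈ K'` because `mz ∈ L₂` and `mL₂ ⊆ K'`. Since `n` and `m²` are coprime, `z ∈ K'`. -/
theorem conj_mem_of_pullback (h : IsCoprimeComparison Q₁ L₁ Q₂ L₂ m n Φ)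
    {K K' : Submodule ℤ V₂} (hK : K ∈ sublattices L₂ m) (hK' : K' ∈ sublattices L₂ m)
    {σ : V₁ ≃ₗ[ℚ] V₁} (hσ : σ ∈ specialOrthogonalGroup Q₁)
    (hP : ∀ x ∈ pullback L₁ Φ K, σ x ∈ pullback L₁ Φ K') {y : V₂} (hy : y ∈ K) :
    Φ (σ (Φ.symm y)) ∈ K' := by
  have h1 : ∀ x ∈ L₁, (m : ℤ) • σ x ∈ L₁ := by
    intro x hx
    rw [← map_zsmul]
    exact (hP _ (zsmul_mem_of_mem_sublattices (h.pullback_mem_sublattices hK) hx)).1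
  have h2 : (m : ℤ) • Φ (σ (Φ.symm y)) ∈ L₂ := (h.zsmul_mem_iff σ hσ).mp h1 y (hK.1 hy)
  have h3 := zsmul_mem_of_mem_sublattices hK' h2
  have h4 : n • Φ (σ (Φ.symm y)) ∈ K' := by
    have h5 : Φ.symm (n • y) ∈ pullback L₁ Φ K :=
      mem_pullback.mpr ⟨h.symm_zsmul_mem y (hK.1 hy), by
        rw [LinearEquiv.apply_symm_apply]; exact K.smul_mem n hy⟩
    have h6 := (mem_pullback.mp (hP _ h5)).2
    simpa only [map_zsmul] using h6
  obtain ⟨u, v, huv⟩ := h.isCoprime.mul_right h.isCoprime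
  have h7 := K'.add_mem (K'.smul_mem u h4) (K'.smul_mem v h3)
  rwa [smul_smul, smul_smul, smul_smul, ← add_smul, mul_assoc, huv, one_smul] at h7

/-- Only `σ x ∈ L₁` is at stake: `nσx ∈ L₁` because `Φ(σx)` lies in `L₂`, and `mσx ∈ L₁` by transfer
of integrality from `L₂`. -/
theorem mem_pullback_of_conj (h : IsCoprimeComparison Q₁ L₁ Q₂ L₂ m n Φ)
    {K K' : Submodule ℤ V₂} (hK : K ∈ sublattices L₂ m) (hK' : K' ∈ sublattices L₂ m)
    {σ : V₁ ≃ₗ[ℚ] V₁} (hσ : σ ∈ specialOrthogonalGroup Q₁)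
    (hP : ∀ y ∈ K, Φ (σ (Φ.symm y)) ∈ K') {x : V₁} (hx : x ∈ pullback L₁ Φ K) :
    σ x ∈ pullback L₁ Φ K' := by
  have h1 : ∀ y ∈ L₂, (m : ℤ) • Φ (σ (Φ.symm y)) ∈ L₂ := by
    intro y hy
    have := hK'.1 (hP _ (zsmul_mem_of_mem_sublattices hK hy))
    simpa only [map_zsmul] using this
  have h2 : (m : ℤ) • σ x ∈ L₁ := (h.zsmul_mem_iff σ hσ).mpr h1 x hx.1
  have h3 : Φ (σ x) ∈ K' := by simpa using hP _ (mem_pullback.mp hx).2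
  have h4 : n • σ x ∈ L₁ := by simpa using h.symm_zsmul_mem _ (hK'.1 h3)
  refine mem_pullback.mpr ⟨?_, h3⟩
  obtain ⟨u, v, huv⟩ := h.isCoprime
  have h7 := L₁.add_mem (L₁.smul_mem u h4) (L₁.smul_mem v h2)
  rwa [smul_smul, smul_smul, ← add_smul, huv, one_smul] at h7

theorem properlyIsometric_pullback_iff (h : IsCoprimeComparison Q₁ L₁ Q₂ L₂ m n Φ)
    {K K' : Submodule ℤ V₂} (hK : K ∈ sublattices L₂ m) (hK' : K' ∈ sublattices L₂ m) :
    ProperlyIsometric Q₁ (pullback L₁ Φ K) (pullback L₁ Φ K') ↔ ProperlyIsometric Q₂ K K' := by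
  rw [properlyIsometric_iff, properlyIsometric_iff]
  constructor
  · rintro ⟨σ, hσ, hP⟩
    refine ⟨_, (h.conj_mem_iff σ).mpr hσ, fun y => ⟨fun hy => ?_, fun hy => ?_⟩⟩
    · have := h.conj_mem_of_pullback hK' hK (inv_mem hσ)
        (fun x hx => (hP (σ⁻¹ x)).mp (by
          rwa [← LinearEquiv.mul_apply, mul_inv_cancel, LinearEquiv.coe_one, id])) hy
      simpa [LinearEquiv.trans_apply, ← LinearEquiv.mul_apply] using this
    · exact h.conj_mem_of_pullback hK hK' hσ (fun x hx => (hP x).mpr hx) hy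
  · rintro ⟨τ, hτ, hP⟩
    set σ : V₁ ≃ₗ[ℚ] V₁ := Φ.trans (τ.trans Φ.symm) with hσdef
    have hconj : Φ.symm.trans (σ.trans Φ) = τ := by ext y; simp [hσdef]
    have hσ : σ ∈ specialOrthogonalGroup Q₁ := by
      rw [← h.conj_mem_iff, hconj]; exact hτ
    have hστ (y : V₂) : Φ (σ (Φ.symm y)) = τ y := by simp [hσdef]
    refine ⟨σ, hσ, fun x => ⟨fun hx => ?_, fun hx => ?_⟩⟩
    · have := h.mem_pullback_of_conj hK' hK (inv_mem hσ)
        (fun y hy => (hP _).mp (by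
          rw [← hστ, LinearEquiv.symm_apply_apply, ← LinearEquiv.mul_apply, mul_inv_cancel]
          simpa using hy)) hx
      rwa [← LinearEquiv.mul_apply, inv_mul_cancel, LinearEquiv.coe_one, id] at this
    · exact h.mem_pullback_of_conj hK hK' hσ
        (fun y hy => by rw [hστ]; exact (hP y).mpr hy) hx

/-- Reflection of proper isometry makes the map on classes injective. Surjectivity is not needed, as
a comparison in the other direction gives the reverse inequality. -/
theorem properClassCount_le (h : IsCoprimeComparison Q₁ L₁ Q₂ L₂ m n Φ)
    [Finite (sublattices L₁ m)] : properClassCount Q₂ L₂ m ≤ properClassCount Q₁ L₁ m := by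
  let f : sublattices L₂ m → sublattices L₁ m :=
    fun K => ⟨pullback L₁ Φ K, h.pullback_mem_sublattices K.2⟩
  refine Nat.card_le_card_of_injective (Quotient.map' (s₁ := sublatticeSetoid Q₂ L₂ m)
    (s₂ := sublatticeSetoid Q₁ L₁ m) f
    fun K K' hKK' => (h.properlyIsometric_pullback_iff K.2 K'.2).mpr hKK') ?_
  rintro ⟨K⟩ ⟨K'⟩ hKK'
  exact Quotient.sound' ((h.properlyIsometric_pullback_iff K.2 K'.2).mp
    (Quotient.exact' hKK'))

end IsCoprimeComparison

end Comparison
-- Counting sublattices, and absolute convergence.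
section Counting

/-- Relations in a finite abelian group of order `m` with two generators, in Hermite normal
form. -/
theorem exists_relations_of_two_generators {A : Type*} [AddCommGroup A] [Finite A] {a b : A}
    (hab : ∀ z : A, ∃ k l : ℤ, z = k • a + l • b) :
    ∃ d ∈ (Nat.card A).divisors, ∃ r < d, ∀ k l : ℤ, k • a + l • b = 0 ↔
      ∃ i j : ℤ, k = i * d + j * r ∧ l = j * (Nat.card A / d : ℕ) := by
  have hd0 : 0 < addOrderOf a := addOrderOf_pos a
  have hdvd : addOrderOf a ∣ Nat.card A := addOrderOf_dvd_natCard a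
  set d := addOrderOf a with hd
  let H := AddSubgroup.zmultiples a
  have hg : Nat.card (A ⧸ H) = Nat.card A / d := by
    have h1 := H.card_eq_card_quotient_mul_card_addSubgroup
    rw [Nat.card_zmultiples] at h1
    rw [h1, Nat.mul_div_cancel _ hd0]
  have hord : addOrderOf (b : A ⧸ H) = Nat.card A / d := by
    rw [← hg]
    apply addOrderOf_eq_card_of_forall_mem_zmultiples
    intro z
    obtain ⟨z, rfl⟩ := QuotientAddGroup.mk_surjective z
    obtain ⟨k, l, rfl⟩ := hab z
    refine ⟨l, ?_⟩
    change ((l • b : A) : A ⧸ H) = _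
    rw [QuotientAddGroup.eq]
    exact ⟨k, by simp⟩
  set g := Nat.card A / d with hgdef
  have hgb : ((g • b : A) : A ⧸ H) = 0 := by
    have := addOrderOf_nsmul_eq_zero (b : A ⧸ H)
    rw [hord] at this
    exact this
  obtain ⟨r', hr'⟩ := (QuotientAddGroup.eq_zero_iff _).mp hgb
  have hr' : r' • a = g • b := hr'
  have hdZ : (d : ℤ) ≠ 0 := by exact_mod_cast hd0.ne'
  have hrnn := Int.emod_nonneg (-r') hdZ
  -- Here `d` is the order of `a` and `g = |A|/d` that of `b` modulo `⟨a⟩`. From `g b = r' a`, the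
  -- relations are generated by `(d, 0)` and `(r, g)` with `r ≡ -r'` modulo `d`.
  refine ⟨d, Nat.mem_divisors.mpr ⟨hdvd, Nat.card_pos.ne'⟩, ((-r') % d).toNat, ?_, fun k l => ?_⟩
  · have := Int.emod_lt_of_pos (-r') (by exact_mod_cast hd0 : (0 : ℤ) < d)
    omega
  have hr : (((-r') % d).toNat : ℤ) • a + (g : ℤ) • b = 0 := by
    rw [Int.toNat_of_nonneg hrnn, hd, mod_addOrderOf_zsmul, neg_smul, hr', natCast_zsmul]
    simp
  set r := ((-r') % d).toNat
  have hda : (d : ℤ) • a = 0 := by rw [natCast_zsmul]; exact addOrderOf_nsmul_eq_zero a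
  constructor
  · intro h
    have hl : (g : ℤ) ∣ l := by
      rw [← hord, addOrderOf_dvd_iff_zsmul_eq_zero]
      change ((l • b : A) : A ⧸ H) = 0
      rw [QuotientAddGroup.eq_zero_iff]
      exact ⟨-k, by simpa [neg_eq_iff_add_eq_zero] using h⟩
    obtain ⟨j, rfl⟩ := hl
    have h2 : (k - j * r) • a = 0 := by
      rw [← h]
      have : (g * j : ℤ) • b = - ((j * r) • a) := by
        rw [mul_comm, mul_smul, mul_smul, ← smul_neg, eq_neg_of_add_eq_zero_right hr]
      rw [this, sub_smul, sub_eq_add_neg]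
    rw [← addOrderOf_dvd_iff_zsmul_eq_zero] at h2
    obtain ⟨i, hi⟩ := h2
    exact ⟨i, j, by linear_combination hi, by ring⟩
  · rintro ⟨i, j, rfl, rfl⟩
    rw [add_smul, mul_smul, hda, smul_zero, zero_add, mul_smul, mul_smul, ← smul_add, hr, smul_zero]

theorem exists_hermite_of_mem_sublattices {V : Type*} [AddCommGroup V]
    {L : Submodule ℤ V} {x y : V} (hx : x ∈ L) (hy : y ∈ L)
    (hL : ∀ v ∈ L, ∃ k l : ℤ, v = k • x + l • y) {m : ℕ} (hm : m ≠ 0) {K : Submodule ℤ V}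
    (hK : K ∈ sublattices L m) :
    ∃ p ∈ m.divisors.sigma fun d => Finset.range d, ∀ v, v ∈ K ↔
      ∃ i j : ℤ, v = (i * p.1 + j * p.2) • x + (j * (m / p.1 : ℕ)) • y := by
  let A := L.toAddSubgroup ⧸ K.toAddSubgroup.addSubgroupOf L.toAddSubgroup
  have hA : Nat.card A = m := hK.2
  have : Finite A := Nat.finite_of_card_ne_zero (by rw [hA]; exact hm)
  let X : L.toAddSubgroup := ⟨x, hx⟩
  let Y : L.toAddSubgroup := ⟨y, hy⟩
  have hmk (k l : ℤ) : k • (X : A) + l • (Y : A) = ((k • X + l • Y : L.toAddSubgroup) : A) := rfl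
  obtain ⟨d, hd, r, hr, h⟩ := exists_relations_of_two_generators (A := A) (a := X) (b := Y) (by
    intro z
    obtain ⟨z, rfl⟩ := QuotientAddGroup.mk_surjective z
    obtain ⟨k, l, hkl⟩ := hL z z.2
    refine ⟨k, l, ?_⟩
    rw [hmk]
    congr 1
    exact Subtype.ext hkl)
  rw [hA] at hd
  rw [hA] at h
  have h' (k l : ℤ) : k • x + l • y ∈ K ↔
      ∃ i j : ℤ, k = i * d + j * r ∧ l = j * (m / d : ℕ) := by
    rw [← h, hmk, QuotientAddGroup.eq_zero_iff]
    rfl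
  refine ⟨⟨d, r⟩, by simp [hr, hm, (Nat.mem_divisors.mp hd).1], fun v => ⟨fun hv => ?_, ?_⟩⟩
  · obtain ⟨k, l, rfl⟩ := hL v (hK.1 hv)
    obtain ⟨i, j, rfl, rfl⟩ := (h' k l).mp hv
    exact ⟨i, j, rfl⟩
  · rintro ⟨i, j, rfl⟩
    exact (h' _ _).mpr ⟨i, j, rfl, rfl⟩

/-- A sublattice is determined by its Hermite pair `(d, r)` with `d ∣ m` and `r < d`, and there are
`∑ d = σ₁(m)` such pairs. -/
theorem finite_sublattices_and_card_le {V : Type*} [AddCommGroup V]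
    {L : Submodule ℤ V} {x y : V} (hx : x ∈ L) (hy : y ∈ L)
    (hL : ∀ v ∈ L, ∃ k l : ℤ, v = k • x + l • y) {m : ℕ} (hm : m ≠ 0) :
    Finite (sublattices L m) ∧
      Nat.card (sublattices L m) ≤ ArithmeticFunction.sigma 1 m := by
  choose p hp hpK using fun K : sublattices L m => exists_hermite_of_mem_sublattices hx hy hL hm K.2
  let f : sublattices L m → (m.divisors.sigma fun d => Finset.range d : Finset (Σ _ : ℕ, ℕ)) :=
    fun K => ⟨p K, hp K⟩
  have hf : Function.Injective f := by
    intro K K' hKK'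
    have h : p K = p K' := congrArg Subtype.val hKK'
    apply Subtype.ext
    ext v
    rw [hpK, hpK, h]
  refine ⟨Finite.of_injective f hf, (Nat.card_le_card_of_injective f hf).trans_eq ?_⟩
  rw [Nat.card_eq_fintype_card, Fintype.card_coe, Finset.card_sigma,
    ArithmeticFunction.sigma_one_apply]
  simp

/-- `σ₁` is the Dirichlet convolution of `1` and `n`, whose series converge absolutely for `Re s >
1` and `Re s > 2`. -/
theorem LSeriesSummable_sigma_one {s : ℂ} (hs : 2 < s.re) :
    LSeriesSummable (fun m => (ArithmeticFunction.sigma 1 m : ℂ)) s := by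
  have h1 : LSeriesSummable (fun m =>
      ((ArithmeticFunction.zeta : ArithmeticFunction ℂ) m : ℂ)) s := by
    have := ArithmeticFunction.LSeriesSummable_zeta_iff.mpr (show 1 < s.re by linarith)
    simpa using this
  have h2 : LSeriesSummable (fun m =>
      ((ArithmeticFunction.pow 1 : ArithmeticFunction ℂ) m : ℂ)) s := by
    refine LSeriesSummable_of_le_const_mul_rpow hs ⟨1, fun n hn => ?_⟩
    norm_num [ArithmeticFunction.natCoe_apply, ArithmeticFunction.pow_apply]
  have h3 := ArithmeticFunction.LSeriesSummable_mul h1 h2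
  refine (LSeriesSummable_congr s fun {n} _ => ?_).mpr h3
  rw [← ArithmeticFunction.zeta_mul_pow_eq_sigma, ← ArithmeticFunction.natCoe_mul]
  rfl

variable {V : Type*} [AddCommGroup V] [Module ℚ V]

theorem LSeriesSummable_properClassCount {Q : QuadraticForm ℚ V} {L : Submodule ℤ V} {x y : V}
    (hx : x ∈ L) (hy : y ∈ L)
    (hL : ∀ v ∈ L, ∃ k l : ℤ, v = k • x + l • y) {s : ℂ} (hs : 2 < s.re) :
    LSeriesSummable (fun m => (properClassCount Q L m : ℂ)) s := by
  refine Summable.of_norm_bounded (LSeriesSummable_sigma_one hs).norm fun m => ?_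
  rcases eq_or_ne m 0 with rfl | hm
  · simp
  refine LSeries.norm_term_le s ?_
  obtain ⟨h1, h2⟩ := finite_sublattices_and_card_le hx hy hL hm
  rw [Complex.norm_natCast, Complex.norm_natCast]
  exact_mod_cast (Nat.card_le_card_of_surjective (Quotient.mk (sublatticeSetoid Q L m))
    Quotient.mk_surjective).trans h2

theorem IsFormCoord.exists_eq_add {Q : QuadraticForm ℚ V} {L : Submodule ℤ V} {a b c : ℤ}
    {e : (ℚ × ℚ) ≃ₗ[ℚ] V} (h : IsFormCoord Q L a b c e) :
    e (1, 0) ∈ L ∧ e (0, 1) ∈ L ∧ ∀ v ∈ L, ∃ k l : ℤ, v = k • e (1, 0) + l • e (0, 1) := by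
  refine ⟨(h.mem_iff _ _).mpr ⟨⟨1, by simp⟩, 0, by simp⟩,
    (h.mem_iff _ _).mpr ⟨⟨0, by simp⟩, 1, by simp⟩, fun v hv => ?_⟩
  obtain ⟨⟨X, Y⟩, rfl⟩ := e.surjective v
  obtain ⟨⟨X, rfl⟩, Y, rfl⟩ := (h.mem_iff _ _).mp hv
  refine ⟨X, Y, ?_⟩
  rw [← map_zsmul, ← map_zsmul, ← map_add]
  simp

end Counting
-- Equality of the class counts and the main theorem.
variable {V₁ : Type*} [AddCommGroup V₁] [Module ℚ V₁] {V₂ : Type*} [AddCommGroup V₂] [Module ℚ V₂]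

theorem IsFormCoord.coeff_ne_zero {Q : QuadraticForm ℚ V₁} {L : Submodule ℤ V₁} {a b c : ℤ}
    {e : (ℚ × ℚ) ≃ₗ[ℚ] V₁} (h : IsFormCoord Q L a b c e) (hQ : Q.PosDef) : a ≠ 0 := by
  rintro rfl
  have h1 := hQ (e (1, 0)) (by simp)
  rw [h.form_eq] at h1
  simp at h1

theorem properClassCount_eq {D : ℤ}
    (hD : ∀ a b c : ℤ, b ^ 2 - 4 * a * c = D →
      ∀ p : ℕ, p.Prime → (p : ℤ) ∣ a → (p : ℤ) ∣ b → (p : ℤ) ∣ c → False)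
    {Q₁ : QuadraticForm ℚ V₁} (hQ₁ : Q₁.PosDef) {L₁ : Submodule ℤ V₁} {a₁ b₁ c₁ : ℤ}
    {e₁ : (ℚ × ℚ) ≃ₗ[ℚ] V₁} (h₁ : IsFormCoord Q₁ L₁ a₁ b₁ c₁ e₁) (hD₁ : b₁ ^ 2 - 4 * a₁ * c₁ = D)
    {Q₂ : QuadraticForm ℚ V₂} (hQ₂ : Q₂.PosDef) {L₂ : Submodule ℤ V₂} {a₂ b₂ c₂ : ℤ}
    {e₂ : (ℚ × ℚ) ≃ₗ[ℚ] V₂} (h₂ : IsFormCoord Q₂ L₂ a₂ b₂ c₂ e₂) (hD₂ : b₂ ^ 2 - 4 * a₂ * c₂ = D)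
    {m : ℕ} (hm : m ≠ 0) : properClassCount Q₁ L₁ m = properClassCount Q₂ L₂ m := by
  -- The coordinates, and hence the comparison maps, depend on `m`; no single `Φ` has to serve every
  -- index.
  obtain ⟨a₁, b₁, c₁, e₁, h₁, hD₁', hm₁⟩ := h₁.exists_isCoprime (hD _ _ _ hD₁) m hm
  obtain ⟨a₂, b₂, c₂, e₂, h₂, hD₂', hm₂⟩ := h₂.exists_isCoprime (hD _ _ _ hD₂) m hm
  rw [hD₁] at hD₁'
  rw [hD₂] at hD₂'
  have hp₁ := hD _ _ _ hD₁'
  have hp₂ := hD _ _ _ hD₂'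
  have ha₁ := h₁.coeff_ne_zero hQ₁
  have ha₂ := h₂.coeff_ne_zero hQ₂
  have hDD := hD₁'.trans hD₂'.symm
  obtain ⟨n, Φ, hΦ⟩ := exists_isCoprimeComparison h₁ hp₁ h₂ hp₂ hDD ha₁ ha₂ hm₁ hm₂
  obtain ⟨n', Ψ, hΨ⟩ := exists_isCoprimeComparison h₂ hp₂ h₁ hp₁ hDD.symm ha₂ ha₁ hm₂ hm₁
  obtain ⟨hx₁, hy₁, hL₁⟩ := h₁.exists_eq_add
  obtain ⟨hx₂, hy₂, hL₂⟩ := h₂.exists_eq_add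
  have := (finite_sublattices_and_card_le hx₁ hy₁ hL₁ hm).1
  have := (finite_sublattices_and_card_le hx₂ hy₂ hL₂ hm).1
  exact le_antisymm hΨ.properClassCount_le hΦ.properClassCount_le

end SublatticeZeta

theorem corollary1p2
    {F : Type*} [Field F] [NumberField F]
    -- `F` is an imaginary quadratic field
    (hF : Module.finrank ℚ F = 2) (hF' : NumberField.IsTotallyComplex F)
    -- `L₁`, `L₂` are integral lattices on positive definite binary quadratic spaces over `ℚ`
    {V₁ : Type*} [AddCommGroup V₁] [Module ℚ V₁] (hV₁ : Module.finrank ℚ V₁ = 2)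
    (Q₁ : QuadraticForm ℚ V₁) (hQ₁ : Q₁.PosDef)
    (L₁ : Submodule ℤ V₁) [Submodule.IsLattice ℚ L₁] (hL₁ : ∀ x ∈ L₁, ∃ n : ℤ, Q₁ x = n)
    {V₂ : Type*} [AddCommGroup V₂] [Module ℚ V₂] (hV₂ : Module.finrank ℚ V₂ = 2)
    (Q₂ : QuadraticForm ℚ V₂) (hQ₂ : Q₂.PosDef)
    (L₂ : Submodule ℤ V₂) [Submodule.IsLattice ℚ L₂] (hL₂ : ∀ x ∈ L₂, ∃ n : ℤ, Q₂ x = n)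
    -- both `-4 d_{L₁}` and `-4 d_{L₂}` are equal to the discriminant of `F`
    (hd₁ : -4 * SublatticeZeta.discriminant Q₁ L₁ = (NumberField.discr F : ℚ))
    (hd₂ : -4 * SublatticeZeta.discriminant Q₂ L₂ = (NumberField.discr F : ℚ)) :
    -- both series converge absolutely in the half plane `Re s > 2`
    (∀ s : ℂ, 2 < s.re →
      LSeriesSummable (fun m => (SublatticeZeta.properClassCount Q₁ L₁ m : ℂ)) s ∧
      LSeriesSummable (fun m => (SublatticeZeta.properClassCount Q₂ L₂ m : ℂ)) s) ∧
    -- they agree as Dirichlet series, coefficient by coefficient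
    (∀ m : ℕ, 1 ≤ m →
      SublatticeZeta.properClassCount Q₁ L₁ m = SublatticeZeta.properClassCount Q₂ L₂ m) ∧
    -- they agree as functions
    SublatticeZeta.properZeta Q₁ L₁ = SublatticeZeta.properZeta Q₂ L₂ := by
  obtain ⟨a₁, b₁, c₁, e₁, h₁, hD₁⟩ := SublatticeZeta.exists_isFormCoord hV₁ Q₁ L₁ hL₁
  obtain ⟨a₂, b₂, c₂, e₂, h₂, hD₂⟩ := SublatticeZeta.exists_isFormCoord hV₂ Q₂ L₂ hL₂
  have hD₁ : b₁ ^ 2 - 4 * a₁ * c₁ = NumberField.discr F := by exact_mod_cast hD₁.symm.trans hd₁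
  have hD₂ : b₂ ^ 2 - 4 * a₂ * c₂ = NumberField.discr F := by exact_mod_cast hD₂.symm.trans hd₂
  obtain ⟨hx₁, hy₁, hg₁⟩ := h₁.exists_eq_add
  obtain ⟨hx₂, hy₂, hg₂⟩ := h₂.exists_eq_add
  have hcount (m : ℕ) (hm : m ≠ 0) :
      SublatticeZeta.properClassCount Q₁ L₁ m = SublatticeZeta.properClassCount Q₂ L₂ m :=
    SublatticeZeta.properClassCount_eq
      (fun _ _ _ h _ hp => SublatticeZeta.isPrimitive_of_discr_eq hF h hp) hQ₁ h₁ hD₁ hQ₂ h₂ hD₂ hm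
  refine ⟨fun s hs => ⟨SublatticeZeta.LSeriesSummable_properClassCount hx₁ hy₁ hg₁ hs,
    SublatticeZeta.LSeriesSummable_properClassCount hx₂ hy₂ hg₂ hs⟩,
    fun m hm => hcount m (by omega), funext fun s => LSeries_congr (fun {m} hm => ?_) s⟩
  rw [hcount m hm]
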